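/- A set $L$ of lines in the plane separates a set $P$ of points if for any two distinct points $p,q\in P$ there is a line $\ell\in L$ such that $p$ and $q$ lie strictly on different sides of $\ell$. The separability of a finite set $P$ is the minimum number of lines in a set of lines that separates $P$. **Theorem.** For every constant $\tau>0$ there are constants $c>0$ and $n_0$, depending only on $\tau$, such that for all $n\ge n_0$ the following holds. If $P$ is a set of $n$ points chosen independently and uniformly at random from the unit square $[0,1]^2$, then with probability at least $1-n^{-\tau}$ the separability of $P$ is at least $$c\,\frac{n^{2/3}\log\log n}{\log n}.$$ -/

import Mathlib

open MeasureTheory ProbabilityTheory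

namespace LineSeparation

/-- The Euclidean plane. -/
abbrev Plane : Type := EuclideanSpace ℝ (Fin 2)

/-- The closed unit square `[0,1] × [0,1]`. -/
def unitSquare : Set Plane := {p | ∀ i, p i ∈ Set.Icc (0 : ℝ) 1}

/-- Lines of the plane: nonempty affine subspaces of dimension one. -/
def IsLine (l : AffineSubspace ℝ Plane) : Prop :=
  (l : Set Plane).Nonempty ∧ Module.finrank ℝ l.direction = 1

/-- `L` separates `P`: any two distinct points of `P` lie strictly on opposite sides of some
member of `L` (in particular neither of the two points lies on that member). -/
def Separates (L : Set (AffineSubspace ℝ Plane)) (P : Set Plane) : Prop :=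
  ∀ p ∈ P, ∀ q ∈ P, p ≠ q → ∃ l ∈ L, l.SOppSide p q

/-- The separability of `P`: the smallest size of a finite set of lines separating `P`.
For finite `P` the minimum is over a nonempty set, see `exists_separating`. -/
noncomputable def separability (P : Set Plane) : ℕ :=
  sInf {k | ∃ L : Finset (AffineSubspace ℝ Plane),
    (∀ l ∈ L, IsLine l) ∧ Separates (L : Set (AffineSubspace ℝ Plane)) P ∧ L.card = k}

/-- Every finite set of points is separated by some finite set of lines. -/
theorem exists_separating {P : Set Plane} (hP : P.Finite) :
    ∃ L : Finset (AffineSubspace ℝ Plane),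
      (∀ l ∈ L, IsLine l) ∧ Separates (L : Set (AffineSubspace ℝ Plane)) P := by
  classical
  refine ⟨hP.toFinset.offDiag.image fun x => AffineSubspace.perpBisector x.1 x.2, ?_, ?_⟩
  · intro l hl
    obtain ⟨⟨p, q⟩, hpq, rfl⟩ := Finset.mem_image.1 hl
    have hne : p ≠ q := (Finset.mem_offDiag.1 hpq).2.2
    refine ⟨⟨_, AffineSubspace.midpoint_mem_perpBisector p q⟩, ?_⟩
    rw [AffineSubspace.direction_perpBisector]
    have : Fact (Module.finrank ℝ Plane = 1 + 1) := ⟨by simp⟩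
    exact Submodule.finrank_orthogonal_span_singleton (vsub_ne_zero.2 hne.symm)
  · intro p hp q hq hne
    refine ⟨AffineSubspace.perpBisector p q, ?_, ?_, ?_, ?_⟩
    · rw [Finset.mem_coe]
      exact Finset.mem_image.2 ⟨(p, q), by simp [hp, hq, hne], rfl⟩
    · exact (wbtw_midpoint ℝ p q).wOppSide₁₃ (AffineSubspace.midpoint_mem_perpBisector p q)
    · simpa using hne
    · simpa using hne

end LineSeparation

/-! Cut the square into an N × N grid with N about n^(2/3). About n²/N², that is of order n^(2/3),
cells receive two points, and each such cell must be met by a separating line, because cells are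
convex. A line meets only O(N) cells, and each cell is doubly occupied with probability of order at
most n²/N⁴, so a line is expected to serve O(1) doubly occupied cells. It therefore suffices that no
line serves more than K, of order log n / log log n, of them.

To handle all lines at once, each is rounded to one of O(N²) strips of at most 7N cells. In one
strip the number of doubly occupied cells has a Poisson-type tail 7^K / K!
(`card_le_card_repeatedValues_inter_strip_le`), which beats the union bound over strips for this K.

That many cells are doubly occupied (`card_repeatedValues_le_le`) is shown by splitting the points
in two blocks: the first occupies many cells, and the second hits many of those. Both claims are
exponential-moment bounds. All the occupancy estimates count maps from points to cells;
`measure_exists_mem_closedCell_le` turns counts into probabilities. -/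

namespace LineSeparation

/-- The values taken at least twice by a map. -/
noncomputable def repeatedValues {ι C : Type*} [Fintype C] (y : ι → C) : Finset C := by
  classical exact Finset.univ.filter fun c => ∃ i j, i ≠ j ∧ y i = c ∧ y j = c

theorem mem_repeatedValues {ι C : Type*} [Fintype C] {y : ι → C} {c : C} :
    c ∈ repeatedValues y ↔ ∃ i j, i ≠ j ∧ y i = c ∧ y j = c := by
  simp [repeatedValues]

/-! ### Occupancy estimates by counting maps into a finite set. -/

section Occupancy

variable {C : Type*} [Fintype C] [DecidableEq C]

/-- One step of the exponential-moment recursion: a new value gains a factor `s` exactly when it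
lies in `A \ B`, which has at least `|A| - K` elements. -/
theorem sum_pow_card_inter_insert_le (A B : Finset C) {s : ℝ} (hs0 : 0 ≤ s) (hs1 : s ≤ 1) {K : ℕ}
    (hB : B.card ≤ K) :
    ∑ c, s ^ (A ∩ insert c B).card ≤
      (Fintype.card C - (1 - s) * ((A.card : ℝ) - K)) * s ^ (A ∩ B).card := by
  have h : ∀ c, s ^ (A ∩ insert c B).card =
      s ^ (A ∩ B).card * (1 - if c ∈ A \ B then 1 - s else 0) := by
    intro c
    by_cases hA : c ∈ A
    · rw [Finset.inter_insert_of_mem hA]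
      by_cases hcB : c ∈ B
      · rw [Finset.insert_eq_of_mem (by simp [hA, hcB])]
        simp [hcB]
      · rw [Finset.card_insert_of_notMem (by simp [hcB])]
        simp [hA, hcB, pow_succ]
    · rw [Finset.inter_insert_of_notMem hA]
      simp [hA]
  simp_rw [h]
  rw [← Finset.mul_sum, Finset.sum_sub_distrib, Finset.sum_ite_mem, mul_comm]
  simp only [Finset.sum_const, Finset.card_univ, nsmul_eq_mul, mul_one, Finset.univ_inter]
  have h1 : (A.card : ℝ) - K ≤ (A \ B).card := by
    have := Finset.le_card_sdiff B A
    have h2 : A.card ≤ (A \ B).card + K := by omega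
    have : (A.card : ℝ) ≤ (A \ B).card + K := by exact_mod_cast h2
    linarith
  have h2 := mul_le_mul_of_nonneg_right h1 (sub_nonneg.2 hs1)
  exact mul_le_mul_of_nonneg_right (by linarith) (by positivity)

/-- Values are revealed one at a time, each costing the same factor because fewer than `K` were seen
before. -/
theorem sum_pow_card_inter_image_le (A : Finset C) {s : ℝ} (hs0 : 0 ≤ s) (hs1 : s ≤ 1) {K : ℕ}
    (k : ℕ) (hk : k ≤ K) :
    ∑ y : Fin k → C, s ^ (A ∩ Finset.univ.image y).card ≤
      (Fintype.card C - (1 - s) * ((A.card : ℝ) - K)) ^ k := by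
  have h0 : 0 ≤ (Fintype.card C : ℝ) - (1 - s) * ((A.card : ℝ) - K) := by
    have h1 : (A.card : ℝ) ≤ Fintype.card C := by exact_mod_cast Finset.card_le_univ A
    have h2 : (0 : ℝ) ≤ K := by positivity
    nlinarith [(A.card.cast_nonneg : (0 : ℝ) ≤ A.card), mul_nonneg (sub_nonneg.2 hs1) h2,
      mul_nonneg hs0 (A.card.cast_nonneg : (0 : ℝ) ≤ A.card)]
  induction k with
  | zero => simp
  | succ k ih =>
    rw [← (Fin.consEquiv fun _ => C).sum_comp, Fintype.sum_prod_type, Finset.sum_comm]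
    have him : ∀ (c : C) (y : Fin k → C),
        Finset.univ.image ((Fin.consEquiv fun _ => C) (c, y)) =
          insert c (Finset.univ.image y) := by
      intro c y
      ext d
      simp [Fin.exists_fin_succ, eq_comm]
    simp_rw [him]
    calc _ ≤ ∑ y : Fin k → C, (Fintype.card C - (1 - s) * ((A.card : ℝ) - K)) *
          s ^ (A ∩ Finset.univ.image y).card := by
          refine Finset.sum_le_sum fun y _ => sum_pow_card_inter_insert_le A _ hs0 hs1 ?_
          have := Finset.card_image_le (s := Finset.univ) (f := y)
          simp only [Finset.card_univ, Fintype.card_fin] at this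
          omega
      _ ≤ _ := by
          rw [← Finset.mul_sum, pow_succ']
          exact mul_le_mul_of_nonneg_left (ih (by omega)) h0

/-- Few maps hit few elements of `A`. -/
theorem card_image_inter_le_mul_pow_le (A : Finset C) {s : ℝ} (hs0 : 0 < s) (hs1 : s ≤ 1)
    (k m : ℕ) :
    ((Finset.univ.filter fun y : Fin k → C => (A ∩ Finset.univ.image y).card ≤ m).card : ℝ) *
      s ^ m ≤ (Fintype.card C - (1 - s) * ((A.card : ℝ) - k)) ^ k := by
  refine le_trans ?_ (sum_pow_card_inter_image_le A hs0.le hs1 k le_rfl)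
  rw [← nsmul_eq_mul]
  refine (Finset.card_nsmul_le_sum _ _ _ fun y hy => ?_).trans
    (Finset.sum_le_sum_of_subset_of_nonneg (Finset.filter_subset _ _) fun y _ _ => by positivity)
  exact pow_le_pow_of_le_one hs0.le hs1 (Finset.mem_filter.1 hy).2

/-- With `s = 1/16` and `A` everything, the moment factor is at most `M/8`. Then `8^(-3l) = 2^(-9l)`
against `s^(2l) = 2^(-8l)` leaves `2^(-l)`. -/
theorem card_image_le_two_mul_le {k l : ℕ} (hl : 3 * l ≤ k) (hk : 16 * k ≤ Fintype.card C) :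
    ((Finset.univ.filter fun y : Fin k → C => (Finset.univ.image y).card ≤ 2 * l).card : ℝ) ≤
      (1 / 2) ^ l * (Fintype.card C : ℝ) ^ k := by
  have h := card_image_inter_le_mul_pow_le (Finset.univ : Finset C) (s := 1 / 16) (by norm_num)
    (by norm_num) k (2 * l)
  simp only [Finset.univ_inter, Finset.card_univ] at h
  set M : ℝ := (Fintype.card C : ℝ)
  have hM : (16 : ℝ) * k ≤ M := by simp only [M]; exact_mod_cast hk
  have hM0 : 0 ≤ M := by positivity
  have h1 : (M - (1 - 1 / 16) * (M - k)) ^ k ≤ (1 / 8) ^ (3 * l) * M ^ k := by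
    calc _ ≤ (1 / 8 * M) ^ k := by
          refine pow_le_pow_left₀ ?_ ?_ _
          · nlinarith [(k.cast_nonneg : (0 : ℝ) ≤ k)]
          · nlinarith [(k.cast_nonneg : (0 : ℝ) ≤ k)]
      _ = (1 / 8) ^ k * M ^ k := mul_pow _ _ _
      _ ≤ _ := by
          refine mul_le_mul_of_nonneg_right ?_ (by positivity)
          exact pow_le_pow_of_le_one (by norm_num) (by norm_num) hl
  have h2 : ((1 : ℝ) / 8) ^ (3 * l) = (1 / 2) ^ l * (1 / 16) ^ (2 * l) := by
    rw [pow_mul, pow_mul, ← mul_pow]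
    norm_num
  rw [h2] at h1
  have h3 : (0 : ℝ) < (1 / 16) ^ (2 * l) := by positivity
  refine le_of_mul_le_mul_right (h.trans (h1.trans (le_of_eq ?_))) h3
  ring

/-- With `s = 1/2` and `|A| - k ≥ k`, each value contributes at most `M - k/2 ≤ M exp(-k/(2M))`. -/
theorem card_inter_image_le_le {A : Finset C} {k m : ℕ} (hA : 2 * k ≤ A.card) :
    ((Finset.univ.filter fun y : Fin k → C => (A ∩ Finset.univ.image y).card ≤ m).card : ℝ) ≤
      2 ^ m * Real.exp (-(k ^ 2 / (2 * Fintype.card C))) * (Fintype.card C : ℝ) ^ k := by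
  have h := card_image_inter_le_mul_pow_le A (s := 1 / 2) (by norm_num) (by norm_num) k m
  have hAM : A.card ≤ Fintype.card C := Finset.card_le_univ A
  rcases Nat.eq_zero_or_pos (Fintype.card C) with h0 | h0
  · obtain rfl : k = 0 := by omega
    simp only [pow_zero, mul_one] at h ⊢
    have h3 : (0 : ℝ) < (1 / 2) ^ m := by positivity
    refine le_of_mul_le_mul_right (h.trans (le_of_eq ?_)) h3
    simp [mul_comm]
  set M : ℝ := (Fintype.card C : ℝ)
  have hM0 : 0 < M := by simp only [M]; exact_mod_cast h0
  have hA' : 2 * (k : ℝ) ≤ A.card := by exact_mod_cast hA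
  have hAM' : (A.card : ℝ) ≤ M := by simp only [M]; exact_mod_cast hAM
  have h1 : (M - (1 - 1 / 2) * ((A.card : ℝ) - k)) ^ k ≤
      Real.exp (-(k ^ 2 / (2 * M))) * M ^ k := by
    calc _ ≤ (Real.exp (-(k / (2 * M))) * M) ^ k := by
          refine pow_le_pow_left₀ (by nlinarith [(k.cast_nonneg : (0 : ℝ) ≤ k)]) ?_ _
          have h4 := Real.add_one_le_exp (-(k / (2 * M)))
          refine le_trans ?_ (mul_le_mul_of_nonneg_right h4 hM0.le)
          have : (-(k / (2 * M)) + 1) * M = M - k / 2 := by field_simp; ring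
          rw [this]
          linarith
      _ = _ := by
          rw [mul_pow, ← Real.exp_nat_mul]
          congr 2
          ring
  have h3 : (0 : ℝ) < (1 / 2) ^ m := by positivity
  refine le_of_mul_le_mul_right (h.trans (h1.trans (le_of_eq ?_))) h3
  have : (2 : ℝ) ^ m * (1 / 2) ^ m = 1 := by rw [← mul_pow]; norm_num
  linear_combination (-(Real.exp (-(k ^ 2 / (2 * M))) * M ^ k)) * this

theorem inter_image_subset_repeatedValues {k l : ℕ} (x : Fin k → C) (z : Fin l → C) :
    Finset.univ.image x ∩ Finset.univ.image z ⊆ repeatedValues (Fin.append x z) := by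
  intro c hc
  simp only [Finset.mem_inter, Finset.mem_image, Finset.mem_univ, true_and] at hc
  obtain ⟨⟨i, hi⟩, j, hj⟩ := hc
  refine mem_repeatedValues.2 ⟨Fin.castAdd l i, Fin.natAdd k j, ?_, by simp [hi], by simp [hj]⟩
  intro h
  have := congrArg Fin.val h
  simp at this
  omega

/-- Few maps have few repeated values. -/
theorem card_repeatedValues_le_le {k l m : ℕ} (hl : 3 * l ≤ k) (hk : 16 * k ≤ Fintype.card C) :
    ((Finset.univ.filter fun y : Fin (k + l) → C => (repeatedValues y).card ≤ m).card : ℝ) ≤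
      ((1 / 2) ^ l + 2 ^ m * Real.exp (-(l ^ 2 / (2 * Fintype.card C)))) *
        (Fintype.card C : ℝ) ^ (k + l) := by
  set M : ℝ := (Fintype.card C : ℝ)
  set E := 2 ^ m * Real.exp (-(l ^ 2 / (2 * M)))
  have hsum : ((Finset.univ.filter fun y : Fin (k + l) → C =>
      (repeatedValues y).card ≤ m).card : ℝ) =
      ∑ x : Fin k → C, ∑ z : Fin l → C,
        if (repeatedValues (Fin.append x z)).card ≤ m then (1 : ℝ) else 0 := by
    rw [← Fintype.sum_prod_type', Finset.card_filter, Nat.cast_sum,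
      ← (Fin.appendEquiv k l).sum_comp]
    refine Finset.sum_congr rfl fun p _ => ?_
    have hp : Fin.appendEquiv k l p = Fin.append p.1 p.2 := rfl
    by_cases h : (repeatedValues (Fin.append p.1 p.2)).card ≤ m
    · rw [if_pos h, if_pos (hp ▸ h), Nat.cast_one]
    · rw [if_neg h, if_neg (hp ▸ h), Nat.cast_zero]
  -- If the first block takes at most `2 * l` values, bound trivially; otherwise its image is a
  -- large enough target for the second block.
  have hin : ∀ x : Fin k → C, (∑ z : Fin l → C,
        if (repeatedValues (Fin.append x z)).card ≤ m then (1 : ℝ) else 0) ≤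
      (if (Finset.univ.image x).card ≤ 2 * l then M ^ l else 0) + E * M ^ l := by
    intro x
    have hE : 0 ≤ E * M ^ l := by positivity
    split_ifs with h
    · calc _ ≤ ∑ z : Fin l → C, (1 : ℝ) := Finset.sum_le_sum fun z _ => by split_ifs <;> norm_num
        _ = M ^ l := by simp [M]
        _ ≤ _ := by linarith
    · rw [zero_add]
      refine le_trans ?_ (card_inter_image_le_le (A := Finset.univ.image x) (k := l) (m := m)
        (by omega))
      rw [← Nat.cast_one, ← Nat.cast_zero]
      simp_rw [← Nat.cast_ite]
      rw [← Nat.cast_sum, ← Finset.card_filter]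
      refine Nat.cast_le.2 (Finset.card_le_card fun z hz => ?_)
      simp only [Finset.mem_filter, Finset.mem_univ, true_and] at hz ⊢
      exact (Finset.card_le_card (inter_image_subset_repeatedValues x z)).trans hz
  rw [hsum]
  refine (Finset.sum_le_sum fun x _ => hin x).trans ?_
  rw [Finset.sum_add_distrib, ← Finset.sum_filter, Finset.sum_const, Finset.sum_const,
    nsmul_eq_mul, nsmul_eq_mul, Finset.card_univ, Fintype.card_fun, Fintype.card_fin, Nat.cast_pow]
  have h1 := mul_le_mul_of_nonneg_right (card_image_le_two_mul_le (C := C) hl hk)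
    (by positivity : 0 ≤ M ^ l)
  refine (add_le_add_left h1 _).trans (le_of_eq ?_)
  simp only [M]
  ring

/-- The number of maps prescribed at two points for each of the values in `T`. -/
theorem card_prescribed_le {ι : Type*} [Fintype ι] [DecidableEq ι] (T : Finset C)
    (g : T → ι × ι) (hg : ∀ c, (g c).1 ≠ (g c).2) :
    (Finset.univ.filter fun y : ι → C => ∀ c : T, y (g c).1 = c ∧ y (g c).2 = c).card *
      Fintype.card C ^ (2 * T.card) ≤ Fintype.card C ^ Fintype.card ι := by
  set F := Finset.univ.filter fun y : ι → C => ∀ c : T, y (g c).1 = c ∧ y (g c).2 = c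
  -- A single admissible map `y₀` already shows that the `2 * T.card` prescribed positions are
  -- distinct: its value at a position recovers `c`.
  rcases F.eq_empty_or_nonempty with h | ⟨y₀, hy₀⟩
  · simp [h]
  have hy₀' : ∀ c : T, y₀ (g c).1 = c ∧ y₀ (g c).2 = c := (Finset.mem_filter.1 hy₀).2
  let f : T × Bool → ι := fun p => if p.2 then (g p.1).1 else (g p.1).2
  have hyf : ∀ y ∈ F, ∀ p, y (f p) = p.1 := by
    intro y hy p
    have := (Finset.mem_filter.1 hy).2 p.1
    simp only [f]
    split_ifs
    exacts [this.1, this.2]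
  have hf : Function.Injective f := by
    rintro ⟨c, b⟩ ⟨d, b'⟩ h
    have h1 := hyf y₀ hy₀ (c, b)
    rw [h, hyf y₀ hy₀ (d, b')] at h1
    obtain rfl : d = c := Subtype.ext h1
    have := hg d
    cases b <;> cases b'
    · rfl
    · exact absurd h.symm this
    · exact absurd h this
    · rfl
  set I := Finset.univ.image f
  have hI : I.card = 2 * T.card := by
    rw [Finset.card_image_of_injective _ hf]
    simp [mul_comm]
  have hsub : F ⊆ Fintype.piFinset fun i => if i ∈ I then {y₀ i} else Finset.univ := by
    intro y hy
    rw [Fintype.mem_piFinset]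
    intro i
    split_ifs with hi
    · obtain ⟨p, -, rfl⟩ := Finset.mem_image.1 hi
      rw [hyf y hy, hyf y₀ hy₀]
      simp
    · simp
  have hcard : (Fintype.piFinset fun i => if i ∈ I then {y₀ i} else Finset.univ).card =
      Fintype.card C ^ (Fintype.card ι - 2 * T.card) := by
    rw [Fintype.card_piFinset, ← hI, ← Finset.card_compl, ← Finset.prod_const,
      ← Finset.prod_mul_prod_compl I]
    rw [Finset.prod_eq_one, one_mul]
    · refine Finset.prod_congr rfl fun i hi => ?_
      rw [if_neg (Finset.mem_compl.1 hi), Finset.card_univ]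
    · intro i hi
      simp [hi]
  calc _ ≤ Fintype.card C ^ (Fintype.card ι - 2 * T.card) * Fintype.card C ^ (2 * T.card) :=
        Nat.mul_le_mul_right _ (hcard ▸ Finset.card_le_card hsub)
    _ = _ := by
        rw [← pow_add, Nat.sub_add_cancel]
        rw [← hI]
        exact Finset.card_le_univ I

/-- Union bound over the two positions chosen for each value of `T`. -/
theorem card_subset_repeatedValues_le (n : ℕ) (T : Finset C) :
    (Finset.univ.filter fun y : Fin n → C => T ⊆ repeatedValues y).card *
      Fintype.card C ^ (2 * T.card) ≤ n ^ (2 * T.card) * Fintype.card C ^ n := by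
  set G := Finset.univ.filter fun g : T → Fin n × Fin n => ∀ c, (g c).1 ≠ (g c).2
  have hsub : (Finset.univ.filter fun y : Fin n → C => T ⊆ repeatedValues y) ⊆
      G.biUnion fun g => Finset.univ.filter fun y : Fin n → C =>
        ∀ c : T, y (g c).1 = c ∧ y (g c).2 = c := by
    intro y hy
    have h : ∀ c : T, ∃ i j, i ≠ j ∧ y i = c ∧ y j = c := fun c =>
      mem_repeatedValues.1 ((Finset.mem_filter.1 hy).2 c.2)
    choose i j hij hi hj using h
    refine Finset.mem_biUnion.2 ⟨fun c => (i c, j c), ?_, ?_⟩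
    · simpa [G] using hij
    · simp [hi, hj]
  have hG : G.card ≤ n ^ (2 * T.card) := by
    refine (Finset.card_le_univ G).trans (le_of_eq ?_)
    simp [pow_mul, sq]
  refine (Nat.mul_le_mul_right _ ((Finset.card_le_card hsub).trans
    Finset.card_biUnion_le)).trans ?_
  rw [Finset.sum_mul]
  refine (Finset.sum_le_card_nsmul G _ (Fintype.card C ^ n) fun g hg => ?_).trans ?_
  · simpa using card_prescribed_le T g (Finset.mem_filter.1 hg).2
  · exact Nat.mul_le_mul_right _ hG

/-- Few maps have many repeated values in `S`. -/
theorem card_le_card_repeatedValues_inter_le (n K : ℕ) (S : Finset C) :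
    (Finset.univ.filter fun y : Fin n → C => K ≤ (repeatedValues y ∩ S).card).card *
      Fintype.card C ^ (2 * K) ≤ S.card.choose K * (n ^ (2 * K) * Fintype.card C ^ n) := by
  -- Union bound over the `K`-element subsets of `S` that could be repeated.
  have hsub : (Finset.univ.filter fun y : Fin n → C => K ≤ (repeatedValues y ∩ S).card) ⊆
      (S.powersetCard K).biUnion fun T =>
        Finset.univ.filter fun y : Fin n → C => T ⊆ repeatedValues y := by
    intro y hy
    obtain ⟨T, hT, hTK⟩ := Finset.exists_subset_card_eq (Finset.mem_filter.1 hy).2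
    refine Finset.mem_biUnion.2 ⟨T, ?_, ?_⟩
    · exact Finset.mem_powersetCard.2 ⟨hT.trans Finset.inter_subset_right, hTK⟩
    · simpa using hT.trans Finset.inter_subset_left
  refine (Nat.mul_le_mul_right _ ((Finset.card_le_card hsub).trans
    Finset.card_biUnion_le)).trans ?_
  rw [Finset.sum_mul]
  refine (Finset.sum_le_card_nsmul _ _ (n ^ (2 * K) * Fintype.card C ^ n) fun T hT => ?_).trans ?_
  · have hTK := (Finset.mem_powersetCard.1 hT).2
    have := card_subset_repeatedValues_le n T
    rwa [hTK] at this
  · simp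

end Occupancy

/-! ### Grid cells, and strips that cover the cells met by a line. -/

/-- The coordinate in which the direction is larger serves as parameter, so the slope is at most 1
in absolute value. -/
theorem exists_line_equation {l : AffineSubspace ℝ Plane} (hl : IsLine l) :
    ∃ a b : ℝ, |a| ≤ 1 ∧ ((∀ z ∈ l, z 1 = a * z 0 + b) ∨ ∀ z ∈ l, z 0 = a * z 1 + b) := by
  obtain ⟨⟨p, hp⟩, hd⟩ := hl
  obtain ⟨v, hv0, hv⟩ := finrank_eq_one_iff'.1 hd
  have hz : ∀ z ∈ l, ∃ r : ℝ, z 0 - p 0 = r * (v : Plane) 0 ∧ z 1 - p 1 = r * (v : Plane) 1 := by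
    intro z hz
    obtain ⟨r, hr⟩ := hv ⟨z -ᵥ p, AffineSubspace.vsub_mem_direction hz hp⟩
    have hr' : r • (v : Plane) = z - p := congrArg Subtype.val hr
    refine ⟨r, ?_, ?_⟩
    · simpa using (congrArg (fun w : Plane => w 0) hr').symm
    · simpa using (congrArg (fun w : Plane => w 1) hr').symm
  have hne : (v : Plane) 0 ≠ 0 ∨ (v : Plane) 1 ≠ 0 := by
    by_contra! h
    refine hv0 (Subtype.ext ?_)
    ext i
    fin_cases i
    exacts [h.1, h.2]
  set x := (v : Plane) 0
  set y := (v : Plane) 1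
  rcases le_total |y| |x| with h | h
  · have hx : x ≠ 0 := by
      rintro hx
      rw [hx, abs_zero, abs_nonpos_iff] at h
      exact hne.elim (fun h' => h' hx) (fun h' => h' h)
    refine ⟨y / x, p 1 - y / x * p 0, ?_, Or.inl fun z hzl => ?_⟩
    · rw [abs_div]
      exact div_le_one_of_le₀ h (abs_nonneg _)
    · obtain ⟨r, h0, h1⟩ := hz z hzl
      have : y / x * (r * x) = r * y := by field_simp
      linear_combination h1 - y / x * h0 - this
  · have hy : y ≠ 0 := by
      rintro hy
      rw [hy, abs_zero, abs_nonpos_iff] at h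
      exact hne.elim (fun h' => h' h) (fun h' => h' hy)
    refine ⟨x / y, p 0 - x / y * p 1, ?_, Or.inr fun z hzl => ?_⟩
    · rw [abs_div]
      exact div_le_one_of_le₀ h (abs_nonneg _)
    · obtain ⟨r, h0, h1⟩ := hz z hzl
      have : x / y * (r * y) = r * x := by field_simp
      linear_combination h0 - x / y * h1 - this

/-- The closed cell of the `N × N` grid on the unit square with the given index. -/
def closedCell (N : ℕ) (c : Fin N × Fin N) : Set Plane :=
  {z | (c.1 ≤ N * z 0 ∧ N * z 0 ≤ c.1 + 1) ∧ (c.2 ≤ N * z 1 ∧ N * z 1 ≤ c.2 + 1)}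

theorem convex_closedCell (N : ℕ) (c : Fin N × Fin N) : Convex ℝ (closedCell N c) := by
  have h : ∀ (i : Fin 2) (j : ℝ), Convex ℝ {z : Plane | j ≤ N * z i ∧ N * z i ≤ j + 1} := by
    intro i j z hz w hw a b ha hb hab
    simp only [Set.mem_ofPred_eq, PiLp.add_apply, PiLp.smul_apply, smul_eq_mul] at hz hw ⊢
    obtain rfl : b = 1 - a := by linarith
    constructor
    · nlinarith [mul_le_mul_of_nonneg_left hz.1 ha, mul_le_mul_of_nonneg_left hw.1 hb]
    · nlinarith [mul_le_mul_of_nonneg_left hz.2 ha, mul_le_mul_of_nonneg_left hw.2 hb]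
  exact (h 0 c.1).inter (h 1 c.2)

theorem exists_mem_line_mem_closedCell {N : ℕ} {c : Fin N × Fin N} {l : AffineSubspace ℝ Plane}
    {p q : Plane} (hp : p ∈ closedCell N c) (hq : q ∈ closedCell N c) (h : l.SOppSide p q) :
    ∃ z ∈ l, z ∈ closedCell N c := by
  obtain ⟨z, hzl, hz⟩ := AffineSubspace.wOppSide_iff_exists_wbtw.1 h.1
  refine ⟨z, hzl, (convex_closedCell N c).segment_subset hp hq ?_⟩
  exact (mem_segment_iff_wbtw).2 hz

/-- The cells of the `N × N` grid near the line `y = (s / N) x + t`, measured in cell widths. -/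
def horizontalStrip (N : ℕ) (s t : ℤ) : Finset (Fin N × Fin N) :=
  Finset.univ.filter fun c => |(N : ℤ) * c.2 - s * c.1 - N * t| ≤ 3 * N

/-- In each column the condition confines `c.2` to a closed interval of length 6, hence to seven
integers. -/
theorem card_horizontalStrip_le (N : ℕ) (s t : ℤ) : (horizontalStrip N s t).card ≤ 7 * N := by
  rcases Nat.eq_zero_or_pos N with rfl | hN
  · simp [horizontalStrip]
  have key : ∀ j ∈ (Finset.univ : Finset (Fin N)),
      ((horizontalStrip N s t).filter fun c => c.1 = j).card ≤ 7 := by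
    intro j _
    set q : ℤ := (s * j + N * t) / N
    have hq : (Finset.Icc (q - 3) (q + 3)).card = 7 := by
      rw [Int.card_Icc]; omega
    rw [← hq]
    refine Finset.card_le_card_of_injOn (fun c => ((c.2 : ℕ) : ℤ)) ?_ ?_
    · rintro ⟨i, k⟩ hc
      simp only [horizontalStrip, Finset.coe_filter, Finset.mem_filter, Finset.mem_univ, true_and,
        Set.mem_ofPred_eq] at hc
      obtain ⟨hc, rfl⟩ := hc
      rw [abs_le] at hc
      have hN' : (0 : ℤ) < N := by exact_mod_cast hN
      have h1 := Int.mul_ediv_add_emod (s * i + N * t) N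
      have h2 := Int.emod_nonneg (s * i + N * t) hN'.ne'
      have h3 := Int.emod_lt_of_pos (s * i + N * t) hN'
      simp only [Finset.coe_Icc, Set.mem_Icc]
      change q - 3 ≤ (k : ℤ) ∧ (k : ℤ) ≤ q + 3
      change (N : ℤ) * q + _ = _ at h1
      constructor
      · have : (N : ℤ) * (q - 3) ≤ N * k := by linarith
        exact le_of_mul_le_mul_left this hN'
      · have : (N : ℤ) * k < N * (q + 3 + 1) := by linarith
        exact Int.lt_add_one_iff.1 (lt_of_mul_lt_mul_left this hN'.le)
    · rintro ⟨i, k⟩ hc ⟨i', k'⟩ hc' h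
      simp only [Finset.coe_filter, Set.mem_ofPred_eq] at hc hc'
      simp only [Nat.cast_inj] at h
      exact Prod.ext (hc.2.trans hc'.2.symm) (Fin.ext h)
  rw [Finset.card_eq_sum_card_fiberwise (f := Prod.fst) (t := Finset.univ)
    (fun _ _ => Finset.mem_coe.2 (Finset.mem_univ _))]
  refine (Finset.sum_le_card_nsmul _ _ _ key).trans (le_of_eq ?_)
  simp [mul_comm]

/-- Round the slope to a multiple of `1/N` and the intercept, in cell widths, to an integer. Over
`N` columns the rounding moves the line by at most 1, which the strip width absorbs. -/
theorem exists_mem_horizontalStrip (N : ℕ) {a : ℝ} (ha : |a| ≤ 1) (b : ℝ) :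
    ∃ s ∈ Finset.Icc (-(N : ℤ)) N, ∃ t ∈ Finset.Icc (-(2 * N + 3 : ℤ)) (2 * N + 3),
      ∀ c : Fin N × Fin N, (∃ u w : ℝ, (c.1 ≤ u ∧ u ≤ c.1 + 1) ∧ (c.2 ≤ w ∧ w ≤ c.2 + 1) ∧
        w = a * u + b) → c ∈ horizontalStrip N s t := by
  rcases Nat.eq_zero_or_pos N with rfl | hN
  · exact ⟨0, by simp, 0, by simp, fun c => c.1.elim0⟩
  have hN' : (0 : ℝ) < N := by exact_mod_cast hN
  set s := round (a * N)
  set t := round b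
  have hs := abs_le.1 (abs_sub_round (a * N))
  have ht := abs_le.1 (abs_sub_round b)
  change -(1 / 2) ≤ a * N - (s : ℝ) ∧ a * N - (s : ℝ) ≤ 1 / 2 at hs
  change -(1 / 2) ≤ b - (t : ℝ) ∧ b - (t : ℝ) ≤ 1 / 2 at ht
  rw [abs_le] at ha
  have hsN : -(N : ℤ) ≤ s ∧ s ≤ N := by
    have h1 : (-(N : ℝ)) - 1 < s := by nlinarith
    have h2 : (s : ℝ) < N + 1 := by nlinarith
    have h1' : (-(N : ℤ)) - 1 < s := by exact_mod_cast h1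
    have h2' : s < (N : ℤ) + 1 := by exact_mod_cast h2
    omega
  have key : ∀ c : Fin N × Fin N, (∃ u w : ℝ, (c.1 ≤ u ∧ u ≤ c.1 + 1) ∧
      (c.2 ≤ w ∧ w ≤ c.2 + 1) ∧ w = a * u + b) →
      |(N : ℤ) * c.2 - s * c.1 - N * t| ≤ 3 * N := by
    rintro ⟨j, k⟩ ⟨u, w, hu, hw, rfl⟩
    simp only at hu hw ⊢
    have hj : ((j : ℕ) : ℝ) ≤ N := by exact_mod_cast j.2.le
    have hj0 : (0 : ℝ) ≤ ((j : ℕ) : ℝ) := by positivity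
    have h1 : |a * (u - j)| ≤ 1 := by
      rw [abs_mul]
      exact mul_le_one₀ (abs_le.2 ha) (abs_nonneg _) (abs_le.2 ⟨by linarith, by linarith⟩)
    rw [abs_le] at h1
    have h2 : |(a * N - s) * j| ≤ 1 / 2 * N := by
      rw [abs_mul, abs_of_nonneg hj0]
      exact mul_le_mul (abs_le.2 hs) hj hj0 (by norm_num)
    rw [abs_le] at h2
    have hr : |(N : ℝ) * k - s * j - N * t| ≤ 3 * N := by
      -- Here 5/2 is 1 for the height of the cell, 1 for the rise across it and 1/2 for rounding
      -- `b`; rounding the slope adds the last 1/2 of the 3.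
      have h3 : |((k : ℕ) : ℝ) - (a * u + b) + a * (u - j) + (b - t)| ≤ 5 / 2 :=
        abs_le.2 ⟨by linarith, by linarith⟩
      have h4 : (N : ℝ) * k - s * j - N * t =
          N * (k - (a * u + b) + a * (u - j) + (b - t)) + (a * N - s) * j := by ring
      rw [h4]
      refine (abs_add_le _ _).trans ?_
      rw [abs_mul, abs_of_pos hN']
      have := mul_le_mul_of_nonneg_left h3 hN'.le
      have := abs_le.2 h2
      linarith
    exact_mod_cast hr
  -- Only a line that meets the grid has its intercept in the allowed range; for the others any
  -- strip works vacuously.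
  by_cases hex : ∃ c : Fin N × Fin N, ∃ u w : ℝ, (c.1 ≤ u ∧ u ≤ c.1 + 1) ∧
      (c.2 ≤ w ∧ w ≤ c.2 + 1) ∧ w = a * u + b
  · obtain ⟨c, hc⟩ := hex
    refine ⟨s, Finset.mem_Icc.2 hsN, t, ?_, fun c hc => by
      simpa [horizontalStrip] using key c hc⟩
    have h := key c hc
    rw [abs_le] at h
    have hN'' : (0 : ℤ) < N := by exact_mod_cast hN
    have h1 : (c.1 : ℤ) ≤ N := by exact_mod_cast c.1.2.le
    have h2 : (c.2 : ℤ) ≤ N := by exact_mod_cast c.2.2.le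
    have h10 : (0 : ℤ) ≤ ((c.1 : ℕ) : ℤ) := by positivity
    have h20 : (0 : ℤ) ≤ ((c.2 : ℕ) : ℤ) := by positivity
    have h3 : |s * c.1| ≤ N * N := by
      rw [abs_mul, abs_of_nonneg h10]
      exact mul_le_mul (abs_le.2 hsN) h1 h10 hN''.le
    rw [abs_le] at h3
    rw [Finset.mem_Icc]
    constructor
    · refine le_of_mul_le_mul_left ?_ hN''
      nlinarith
    · refine le_of_mul_le_mul_left ?_ hN''
      nlinarith
  · exact ⟨0, by simp, 0, by simp; omega, fun c hc => (hex ⟨c, hc⟩).elim⟩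

/-- A family of sets of grid cells such that the cells met by any line lie in one member. -/
noncomputable def strips (N : ℕ) : Finset (Finset (Fin N × Fin N)) :=
  ((Finset.Icc (-(N : ℤ)) N ×ˢ Finset.Icc (-(2 * N + 3 : ℤ)) (2 * N + 3)).image
    fun p => horizontalStrip N p.1 p.2) ∪
  ((Finset.Icc (-(N : ℤ)) N ×ˢ Finset.Icc (-(2 * N + 3 : ℤ)) (2 * N + 3)).image
    fun p => (horizontalStrip N p.1 p.2).map (Equiv.prodComm _ _).toEmbedding)

theorem card_strips_le (N : ℕ) : (strips N).card ≤ 2 * ((2 * N + 1) * (4 * N + 7)) := by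
  have h : (Finset.Icc (-(N : ℤ)) N ×ˢ Finset.Icc (-(2 * N + 3 : ℤ)) (2 * N + 3)).card =
      (2 * N + 1) * (4 * N + 7) := by
    rw [Finset.card_product, Int.card_Icc, Int.card_Icc]
    congr 1 <;> omega
  have h1 : ∀ f : ℤ × ℤ → Finset (Fin N × Fin N),
      ((Finset.Icc (-(N : ℤ)) N ×ˢ Finset.Icc (-(2 * N + 3 : ℤ)) (2 * N + 3)).image f).card ≤
        (2 * N + 1) * (4 * N + 7) := fun f => Finset.card_image_le.trans_eq h
  exact (Finset.card_union_le _ _).trans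
    ((add_le_add (h1 _) (h1 _)).trans_eq (two_mul _).symm)

theorem card_le_of_mem_strips {N : ℕ} {S : Finset (Fin N × Fin N)} (hS : S ∈ strips N) :
    S.card ≤ 7 * N := by
  simp only [strips, Finset.mem_union, Finset.mem_image] at hS
  obtain ⟨p, -, rfl⟩ | ⟨p, -, rfl⟩ := hS
  · exact card_horizontalStrip_le _ _ _
  · rw [Finset.card_map]
    exact card_horizontalStrip_le _ _ _

theorem exists_strip_of_line (N : ℕ) {l : AffineSubspace ℝ Plane} (hl : IsLine l) :
    ∃ S ∈ strips N, ∀ c, (∃ z ∈ l, z ∈ closedCell N c) → c ∈ S := by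
  obtain ⟨a, b, ha, h⟩ := exists_line_equation hl
  obtain ⟨s, hs, t, ht, hst⟩ := exists_mem_horizontalStrip N ha (N * b)
  have hmem : (s, t) ∈ Finset.Icc (-(N : ℤ)) N ×ˢ Finset.Icc (-(2 * N + 3 : ℤ)) (2 * N + 3) :=
    Finset.mem_product.2 ⟨hs, ht⟩
  rcases h with h | h
  · refine ⟨_, Finset.mem_union_left _ (Finset.mem_image_of_mem _ hmem), ?_⟩
    rintro c ⟨z, hz, hc⟩
    exact hst c ⟨N * z 0, N * z 1, hc.1, hc.2, by rw [h z hz]; ring⟩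
  · refine ⟨_, Finset.mem_union_right _ (Finset.mem_image_of_mem _ hmem), ?_⟩
    rintro c ⟨z, hz, hc⟩
    refine Finset.mem_map.2 ⟨c.swap, hst _ ⟨N * z 1, N * z 0, hc.2, hc.1, ?_⟩, Prod.swap_swap c⟩
    rw [h z hz]; ring

/-! ### Doubly occupied cells force many lines. -/

theorem exists_separability_eq {P : Set Plane} (hP : P.Finite) :
    ∃ L : Finset (AffineSubspace ℝ Plane), (∀ l ∈ L, IsLine l) ∧
      Separates (L : Set (AffineSubspace ℝ Plane)) P ∧ L.card = separability P := by
  obtain ⟨L, hL, hLP⟩ := exists_separating hP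
  exact Nat.sInf_mem (s := {k | ∃ L : Finset (AffineSubspace ℝ Plane),
    (∀ l ∈ L, IsLine l) ∧ Separates (L : Set (AffineSubspace ℝ Plane)) P ∧ L.card = k})
    ⟨_, L, hL, hLP, rfl⟩

/-- If each strip has at most `K` cells containing two of the points, then many lines are needed
to separate the points. -/
theorem card_repeatedValues_le_separability_mul {N n K : ℕ} {x : Fin n → Plane}
    (hx : Function.Injective x) {y : Fin n → Fin N × Fin N} (hy : ∀ i, x i ∈ closedCell N (y i))
    (hK : ∀ S ∈ strips N, (repeatedValues y ∩ S).card ≤ K) :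
    (repeatedValues y).card ≤ separability (Set.range x) * K := by
  classical
  obtain ⟨L, hL, hsep, hcard⟩ := exists_separability_eq (Set.finite_range x)
  choose! S hS hlS using fun l (hl : l ∈ L) => exists_strip_of_line N (hL l hl)
  have hsub : repeatedValues y ⊆ L.biUnion fun l => repeatedValues y ∩ S l := by
    intro c hc
    obtain ⟨i, j, hij, hi, hj⟩ := mem_repeatedValues.1 hc
    obtain ⟨l, hl, hopp⟩ := hsep (x i) ⟨i, rfl⟩ (x j) ⟨j, rfl⟩ (hx.ne hij)
    refine Finset.mem_biUnion.2 ⟨l, hl, Finset.mem_inter.2 ⟨hc, hlS l hl c ?_⟩⟩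
    exact exists_mem_line_mem_closedCell (hi ▸ hy i) (hj ▸ hy j) hopp
  rw [← hcard]
  refine (Finset.card_le_card hsub).trans (Finset.card_biUnion_le_card_mul _ _ _ fun l hl => ?_)
  exact hK _ (hS l hl)

/-! ### Cell volumes and independent uniform points. -/

theorem volume_box (a b : Fin 2 → ℝ) :
    volume {p : Plane | ∀ i, p i ∈ Set.Icc (a i) (b i)} =
      ∏ i, ENNReal.ofReal (b i - a i) := by
  have h : {p : Plane | ∀ i, p i ∈ Set.Icc (a i) (b i)} =
      (WithLp.ofLp : Plane → Fin 2 → ℝ) ⁻¹' Set.Icc a b := by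
    ext p
    simp [Pi.le_def, forall_and]
  rw [h, (PiLp.volume_preserving_ofLp (Fin 2)).measure_preimage
    measurableSet_Icc.nullMeasurableSet, Real.volume_Icc_pi]

theorem measurableSet_box (a b : Fin 2 → ℝ) :
    MeasurableSet {p : Plane | ∀ i, p i ∈ Set.Icc (a i) (b i)} := by
  have h : {p : Plane | ∀ i, p i ∈ Set.Icc (a i) (b i)} =
      (WithLp.ofLp : Plane → Fin 2 → ℝ) ⁻¹' Set.Icc a b := by
    ext p
    simp [Pi.le_def, forall_and]
  rw [h]
  exact (PiLp.volume_preserving_ofLp (Fin 2)).measurable measurableSet_Icc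

theorem volume_unitSquare : volume unitSquare = 1 := by
  exact (volume_box (fun _ => 0) (fun _ => 1)).trans (by simp)

theorem measurableSet_unitSquare : MeasurableSet unitSquare :=
  measurableSet_box (fun _ => 0) (fun _ => 1)

theorem closedCell_eq_box {N : ℕ} (hN : 0 < N) (c : Fin N × Fin N) :
    closedCell N c = {p : Plane | ∀ i, p i ∈ Set.Icc
      ((![(c.1 : ℝ) / N, (c.2 : ℝ) / N] : Fin 2 → ℝ) i)
      ((![((c.1 : ℝ) + 1) / N, ((c.2 : ℝ) + 1) / N] : Fin 2 → ℝ) i)} := by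
  have hN' : (0 : ℝ) < N := by exact_mod_cast hN
  ext z
  simp [closedCell, Fin.forall_fin_two, div_le_iff₀ hN', le_div_iff₀ hN', mul_comm]

theorem volume_closedCell {N : ℕ} (hN : 0 < N) (c : Fin N × Fin N) :
    volume (closedCell N c) = ENNReal.ofReal ((1 / (N : ℝ)) ^ 2) := by
  rw [closedCell_eq_box hN, volume_box, Fin.prod_univ_two, sq, ENNReal.ofReal_mul (by positivity)]
  congr 2 <;> simp <;> ring

theorem measurableSet_closedCell {N : ℕ} (hN : 0 < N) (c : Fin N × Fin N) :
    MeasurableSet (closedCell N c) := by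
  rw [closedCell_eq_box hN]
  exact measurableSet_box _ _

theorem exists_mem_closedCell {N : ℕ} (hN : 0 < N) {p : Plane} (hp : p ∈ unitSquare) :
    ∃ c, p ∈ closedCell N c := by
  have hN' : (0 : ℝ) < N := by exact_mod_cast hN
  have h : ∀ x : ℝ, x ∈ Set.Icc (0 : ℝ) 1 → ∃ j : Fin N, j ≤ N * x ∧ N * x ≤ j + 1 := by
    intro x hx
    have h0 : 0 ≤ N * x := mul_nonneg hN'.le hx.1
    by_cases hlt : ⌊N * x⌋₊ < N
    · exact ⟨⟨_, hlt⟩, Nat.floor_le h0, (Nat.lt_floor_add_one _).le⟩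
    · refine ⟨⟨N - 1, by omega⟩, ?_⟩
      have h1 : (N : ℝ) ≤ N * x := (Nat.le_floor_iff h0).1 (not_lt.1 hlt)
      have h2 : N * x ≤ N := by nlinarith [hx.2]
      simp only [Nat.cast_sub (show 1 ≤ N from hN), Nat.cast_one]
      constructor <;> linarith
  obtain ⟨j, hj⟩ := h _ (hp 0)
  obtain ⟨k, hk⟩ := h _ (hp 1)
  exact ⟨(j, k), hj, hk⟩

section Random

variable {Ω : Type*} [MeasurableSpace Ω] {μ : Measure Ω}

theorem aemeasurable_of_isUniform_unitSquare {X : Ω → Plane}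
    (hX : pdf.IsUniform X unitSquare μ volume) : AEMeasurable X μ :=
  hX.aemeasurable (by simp [volume_unitSquare]) (by simp [volume_unitSquare])

theorem measure_preimage_le_volume {X : Ω → Plane} (hX : pdf.IsUniform X unitSquare μ volume)
    {A : Set Plane} (hA : MeasurableSet A) : μ (X ⁻¹' A) ≤ volume A := by
  rw [hX.measure_preimage (by simp [volume_unitSquare]) (by simp [volume_unitSquare]) hA,
    volume_unitSquare, div_one]
  exact measure_mono Set.inter_subset_right

theorem ae_mem_unitSquare [IsProbabilityMeasure μ] {X : Ω → Plane}
    (hX : pdf.IsUniform X unitSquare μ volume) : ∀ᵐ ω ∂μ, X ω ∈ unitSquare := by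
  have h := hX.measure_preimage (by simp [volume_unitSquare]) (by simp [volume_unitSquare])
    measurableSet_unitSquare.compl
  rw [Set.inter_compl_self, measure_empty, ENNReal.zero_div] at h
  exact h

/-- The diagonal is null for the product law, since its slices are single points. -/
theorem ae_ne_of_isUniform [IsProbabilityMeasure μ] {X Y : Ω → Plane}
    (hX : pdf.IsUniform X unitSquare μ volume) (hY : pdf.IsUniform Y unitSquare μ volume)
    (h : IndepFun X Y μ) : ∀ᵐ ω ∂μ, X ω ≠ Y ω := by
  have hXm := aemeasurable_of_isUniform_unitSquare hX
  have hYm := aemeasurable_of_isUniform_unitSquare hY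
  have hmap := (indepFun_iff_map_prod_eq_prod_map_map hXm hYm).1 h
  have hdiag : MeasurableSet (Set.diagonal Plane) := measurableSet_diagonal
  have h0 : (μ.map fun ω => (X ω, Y ω)) (Set.diagonal Plane) = 0 := by
    rw [hmap, Measure.prod_apply hdiag]
    refine (lintegral_congr fun x => ?_).trans lintegral_zero
    have : Prod.mk x ⁻¹' Set.diagonal Plane = {x} := by
      ext y
      simp [eq_comm]
    rw [this]
    exact hY.absolutelyContinuous (measure_singleton x)
  rw [Measure.map_apply_of_aemeasurable (hXm.prodMk hYm) hdiag] at h0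
  exact ae_iff.2 (measure_mono_null (fun ω hω => not_not.1 hω) h0)

/-- Each fixed assignment has probability at most `N^(-2n)`; sum over `E`. Closed cells overlap, but
a union bound needs neither a unique nor a measurable choice of `y`. -/
theorem measure_exists_mem_closedCell_le {n N : ℕ} (hN : 0 < N) {X : Fin n → Ω → Plane}
    (hX : ∀ i, pdf.IsUniform (X i) unitSquare μ volume) (hind : iIndepFun X μ)
    (E : Finset (Fin n → Fin N × Fin N)) {b : ℝ}
    (hE : (E.card : ℝ) ≤ b * (Fintype.card (Fin N × Fin N) : ℝ) ^ n) :
    μ {ω | ∃ y ∈ E, ∀ i, X i ω ∈ closedCell N (y i)} ≤ ENNReal.ofReal b := by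
  have hN' : (0 : ℝ) < N := by exact_mod_cast hN
  have hy : ∀ y : Fin n → Fin N × Fin N, μ {ω | ∀ i, X i ω ∈ closedCell N (y i)} ≤
      ENNReal.ofReal ((1 / (N : ℝ)) ^ 2) ^ n := by
    intro y
    have h := hind.measure_inter_preimage_eq_mul Finset.univ (sets := fun i => closedCell N (y i))
      fun i _ => measurableSet_closedCell hN _
    have hset : {ω | ∀ i, X i ω ∈ closedCell N (y i)} =
        ⋂ i ∈ Finset.univ, X i ⁻¹' closedCell N (y i) := by
      ext ω
      simp
    rw [hset, h]
    refine (Finset.prod_le_prod' fun i _ => (measure_preimage_le_volume (hX i)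
      (measurableSet_closedCell hN _)).trans_eq (volume_closedCell hN _)).trans_eq ?_
    simp
  have hset : {ω | ∃ y ∈ E, ∀ i, X i ω ∈ closedCell N (y i)} =
      ⋃ y ∈ E, {ω | ∀ i, X i ω ∈ closedCell N (y i)} := by
    ext ω
    simp
  rw [hset]
  refine (measure_biUnion_finset_le _ _).trans ((Finset.sum_le_card_nsmul _ _ _
    fun y _ => hy y).trans ?_)
  rw [nsmul_eq_mul, ← ENNReal.ofReal_pow (by positivity), ← ENNReal.ofReal_natCast,
    ← ENNReal.ofReal_mul (by positivity)]
  refine ENNReal.ofReal_le_ofReal ?_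
  refine (mul_le_mul_of_nonneg_right hE (by positivity)).trans (le_of_eq ?_)
  have : (Fintype.card (Fin N × Fin N) : ℝ) * (1 / (N : ℝ)) ^ 2 = 1 := by
    simp
    field_simp
  rw [mul_assoc, ← mul_pow, this, one_pow, mul_one]

end Random

/-! ### The failure probability for given parameters. -/

/-- `choose (7N) K ≤ (7N)^K / K!`, while the pair probability `(n²/N⁴)^K` is at most `N^(-K)`
because `n² ≤ N³`. -/
theorem card_le_card_repeatedValues_inter_strip_le {n N K : ℕ} (hN : 0 < N) (hn : n ^ 2 ≤ N ^ 3)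
    {S : Finset (Fin N × Fin N)} (hS : S ∈ strips N) :
    ((Finset.univ.filter fun y : Fin n → Fin N × Fin N =>
      K ≤ (repeatedValues y ∩ S).card).card : ℝ) ≤
      7 ^ K / K.factorial * (Fintype.card (Fin N × Fin N) : ℝ) ^ n := by
  have hN' : (0 : ℝ) < N := by exact_mod_cast hN
  have h := card_le_card_repeatedValues_inter_le n K S
  have hc : (Fintype.card (Fin N × Fin N) : ℝ) = (N : ℝ) ^ 2 := by simp [sq]
  set M := Fintype.card (Fin N × Fin N)
  have h' : ((Finset.univ.filter fun y : Fin n → Fin N × Fin N =>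
      K ≤ (repeatedValues y ∩ S).card).card : ℝ) * (M : ℝ) ^ (2 * K) ≤
      (S.card.choose K : ℝ) * ((n : ℝ) ^ (2 * K) * (M : ℝ) ^ n) := by exact_mod_cast h
  have hch : (S.card.choose K : ℝ) ≤ (7 * (N : ℝ)) ^ K / K.factorial := by
    refine (Nat.choose_le_pow_div K S.card).trans ?_
    have : (S.card : ℝ) ≤ 7 * N := by exact_mod_cast card_le_of_mem_strips hS
    gcongr
  have hn' : (n : ℝ) ^ (2 * K) ≤ (N : ℝ) ^ (3 * K) := by
    rw [pow_mul, pow_mul]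
    exact pow_le_pow_left₀ (by positivity) (by exact_mod_cast hn) K
  have hpos : (0 : ℝ) < (M : ℝ) ^ (2 * K) := by rw [hc]; positivity
  refine le_of_mul_le_mul_right (h'.trans ?_) hpos
  calc _ ≤ (7 * (N : ℝ)) ^ K / K.factorial * ((N : ℝ) ^ (3 * K) * (M : ℝ) ^ n) := by gcongr
    _ = _ := by
      rw [hc, mul_pow]
      ring

theorem measure_separability_mul_le {k l N m K : ℕ} (hN : 0 < N) (hl : 3 * l ≤ k)
    (hk : 16 * k ≤ N ^ 2) (hn : (k + l) ^ 2 ≤ N ^ 3) {Ω : Type*} [MeasurableSpace Ω]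
    {μ : Measure Ω} [IsProbabilityMeasure μ] {X : Fin (k + l) → Ω → Plane}
    (hX : ∀ i, pdf.IsUniform (X i) unitSquare μ volume) (hind : iIndepFun X μ) :
    μ {ω | separability (Set.range fun i => X i ω) * K ≤ m} ≤
      ENNReal.ofReal ((1 / 2) ^ l + 2 ^ m * Real.exp (-(l ^ 2 / (2 * (N : ℝ) ^ 2))) +
        (strips N).card * (7 ^ (K + 1) / (K + 1).factorial)) := by
  classical
  have hc : (Fintype.card (Fin N × Fin N) : ℝ) = (N : ℝ) ^ 2 := by simp [sq]
  set E : Finset (Fin (k + l) → Fin N × Fin N) :=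
    (Finset.univ.filter fun y => (repeatedValues y).card ≤ m) ∪
    (strips N).biUnion fun S => Finset.univ.filter fun y => K + 1 ≤ (repeatedValues y ∩ S).card
  have hE : (E.card : ℝ) ≤ ((1 / 2) ^ l + 2 ^ m * Real.exp (-(l ^ 2 / (2 * (N : ℝ) ^ 2))) +
        (strips N).card * (7 ^ (K + 1) / (K + 1).factorial)) *
        (Fintype.card (Fin N × Fin N) : ℝ) ^ (k + l) := by
    have h1 := card_repeatedValues_le_le (C := Fin N × Fin N) (m := m) hl
      (by simpa [sq] using hk)
    rw [hc] at h1
    have h2 : (((strips N).biUnion fun S => Finset.univ.filter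
        fun y : Fin (k + l) → Fin N × Fin N => K + 1 ≤ (repeatedValues y ∩ S).card).card : ℝ) ≤
        (strips N).card * (7 ^ (K + 1) / (K + 1).factorial *
          (Fintype.card (Fin N × Fin N) : ℝ) ^ (k + l)) := by
      refine (Nat.cast_le.2 Finset.card_biUnion_le).trans ?_
      rw [Nat.cast_sum, ← nsmul_eq_mul]
      exact Finset.sum_le_card_nsmul _ _ _ fun S hS =>
        card_le_card_repeatedValues_inter_strip_le hN hn hS
    rw [hc] at h2 ⊢
    have h3 : (E.card : ℝ) ≤ _ := (Nat.cast_le.2 (Finset.card_union_le _ _)).trans_eq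
      (Nat.cast_add _ _)
    refine h3.trans ((add_le_add h1 h2).trans (le_of_eq ?_))
    ring
  refine le_trans (measure_mono_ae ?_) (measure_exists_mem_closedCell_le hN hX hind E hE)
  have hsq : ∀ᵐ ω ∂μ, ∀ i, X i ω ∈ unitSquare := ae_all_iff.2 fun i => ae_mem_unitSquare (hX i)
  have hne : ∀ᵐ ω ∂μ, ∀ i j, i ≠ j → X i ω ≠ X j ω :=
    ae_all_iff.2 fun i => ae_all_iff.2 fun j => Filter.eventually_imp_distrib_left.2 fun hij =>
      ae_ne_of_isUniform (hX i) (hX j) (hind.indepFun hij)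
  filter_upwards [hsq, hne] with ω h1 h2 h3
  have hinj : Function.Injective fun i => X i ω := fun i j hij => by
    by_contra h
    exact h2 i j h hij
  choose y hy using fun i => exists_mem_closedCell hN (h1 i)
  refine ⟨y, ?_, hy⟩
  by_contra hyE
  simp only [E, Finset.mem_union, Finset.mem_biUnion, Finset.mem_filter, Finset.mem_univ,
    true_and, not_or, not_exists, not_and, not_le] at hyE
  have := card_repeatedValues_le_separability_mul hinj hy (K := K)
    fun S hS => Nat.lt_succ_iff.1 (hyE.2 S hS)
  have h3' : separability (Set.range fun i => X i ω) * K ≤ m := h3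
  omega

/-! ### Choice of parameters and asymptotics. -/

open Filter in
theorem eventually_growth_conditions (τ : ℝ) :
    ∀ᶠ x : ℝ in atTop, 4096 ≤ x ∧ τ * Real.log x + 2 ≤ x ^ (2 / 3 : ℝ) / 400 ∧
      1 ≤ Real.log (Real.log x) ∧
      20 * Real.log (Real.log x) ≤ Real.sqrt (Real.log x) ∧
      264 * (x ^ (2 / 3 : ℝ)) ^ 2 ≤ x ^ 2 := by
  have hlog := Real.tendsto_log_atTop
  have h2 : ∀ᶠ x : ℝ in atTop, τ * Real.log x + 2 ≤ x ^ (2 / 3 : ℝ) / 400 := by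
    have h := ((isLittleO_log_rpow_atTop (r := 2 / 3) (by norm_num)).const_mul_left τ).bound
      (c := 1 / 800) (by norm_num)
    have h' := (tendsto_rpow_atTop (y := 2 / 3) (by norm_num)).eventually_ge_atTop 1600
    filter_upwards [h, h'] with x hx hx'
    rw [Real.norm_eq_abs, Real.norm_eq_abs, abs_of_pos (by linarith : 0 < x ^ (2 / 3 : ℝ))] at hx
    linarith [le_abs_self (τ * Real.log x)]
  have h4 : ∀ᶠ x : ℝ in atTop, 20 * Real.log x ≤ Real.sqrt x := by
    have h := (isLittleO_log_rpow_atTop (r := 1 / 2) (by norm_num)).bound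
      (c := 1 / 20) (by norm_num)
    filter_upwards [h] with x hx
    rw [← Real.sqrt_eq_rpow, Real.norm_eq_abs, Real.norm_eq_abs,
      abs_of_nonneg (Real.sqrt_nonneg x)] at hx
    linarith [le_abs_self (Real.log x)]
  have h5 : ∀ᶠ x : ℝ in atTop, 264 * (x ^ (2 / 3 : ℝ)) ^ 2 ≤ x ^ 2 := by
    have h' := (tendsto_rpow_atTop (y := 2 / 3) (by norm_num)).eventually_ge_atTop 264
    filter_upwards [h', eventually_gt_atTop 0] with x hx hx0
    have : x ^ 2 = (x ^ (2 / 3 : ℝ)) ^ 3 := by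
      rw [← Real.rpow_natCast (x ^ (2 / 3 : ℝ)), ← Real.rpow_mul hx0.le, ← Real.rpow_natCast]
      norm_num
    rw [this, pow_succ' (x ^ (2 / 3 : ℝ)) 2]
    exact mul_le_mul_of_nonneg_right hx (by positivity)
  filter_upwards [eventually_ge_atTop 4096, h2, (hlog.comp hlog).eventually_ge_atTop 1,
    hlog.eventually h4, h5] with x a b c d e
  exact ⟨a, b, c, d, e⟩

/-- From `K! ≥ (K/e)^K` and `K ≥ 20 √L ≥ 7e √L`, the ratio is at most `(√L)^(-K) = exp(-(K/2) log
L)`. -/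
theorem pow_div_factorial_le_exp_neg {L C : ℝ} (hC : 1 ≤ C) (h1 : 1 ≤ Real.log L)
    (h20 : 20 * Real.log L ≤ Real.sqrt L) {K : ℕ} (hK : C * (L / Real.log L) ≤ K) :
    (7 : ℝ) ^ K / K.factorial ≤ Real.exp (-(C * L / 2)) := by
  -- `Real.log` may be positive at negative arguments, but there `Real.sqrt` is 0, contradicting
  -- `h20`.
  have hL : 0 < L := by
    by_contra h
    rw [Real.sqrt_eq_zero'.2 (not_lt.1 h)] at h20
    linarith
  have hl : 0 < Real.log L := by linarith
  have hsq : Real.sqrt L * Real.sqrt L = L := Real.mul_self_sqrt hL.le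
  have hs0 : 0 < Real.sqrt L := Real.sqrt_pos.2 hL
  have hbig : 20 * Real.sqrt L ≤ K := by
    refine le_trans ?_ ((le_mul_of_one_le_left (by positivity) hC).trans hK)
    rw [le_div_iff₀ hl]
    nlinarith
  have hK0 : (0 : ℝ) < K := by linarith
  have hfac : (0 : ℝ) < K.factorial := by exact_mod_cast K.factorial_pos
  have h2 : (K : ℝ) ^ K ≤ Real.exp K * K.factorial := by
    have := Real.pow_div_factorial_le_exp (K : ℝ) hK0.le K
    rwa [div_le_iff₀ hfac] at this
  have h3 : (7 : ℝ) ^ K * Real.exp K ≤ Real.exp (-(C * L / 2)) * (K : ℝ) ^ K := by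
    have h4 : (7 * Real.exp 1 * Real.sqrt L) ^ K ≤ (K : ℝ) ^ K := by
      refine pow_le_pow_left₀ (by positivity) (le_trans ?_ hbig) K
      refine mul_le_mul_of_nonneg_right ?_ hs0.le
      linarith [Real.exp_one_lt_d9]
    have h5 : Real.exp (C * L / 2) ≤ Real.sqrt L ^ K := by
      rw [← Real.exp_log hs0, ← Real.exp_nat_mul, Real.exp_le_exp, Real.log_sqrt hL.le]
      have := mul_le_mul_of_nonneg_right hK hl.le
      have h6 : C * (L / Real.log L) * Real.log L = C * L := by field_simp
      linarith
    rw [mul_pow, mul_pow, ← Real.exp_nat_mul, mul_one] at h4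
    rw [Real.exp_neg, inv_mul_eq_div, le_div_iff₀ (Real.exp_pos _)]
    exact (mul_le_mul_of_nonneg_left h5 (by positivity)).trans h4
  rw [div_le_iff₀ hfac]
  have hKK : (0 : ℝ) < (K : ℝ) ^ K := by positivity
  refine le_of_mul_le_mul_right ?_ hKK
  calc (7 : ℝ) ^ K * (K : ℝ) ^ K ≤ 7 ^ K * (Real.exp K * K.factorial) := by gcongr
    _ = 7 ^ K * Real.exp K * K.factorial := by ring
    _ ≤ Real.exp (-(C * L / 2)) * (K : ℝ) ^ K * K.factorial := by gcongr
    _ = _ := by ring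

theorem failure_bound_le {τ : ℝ} (hτ : 0 < τ) {n : ℕ}
    (h : 4096 ≤ (n : ℝ) ∧ τ * Real.log n + 2 ≤ (n : ℝ) ^ (2 / 3 : ℝ) / 400 ∧
      1 ≤ Real.log (Real.log n) ∧
      20 * Real.log (Real.log n) ≤ Real.sqrt (Real.log n) ∧
      264 * ((n : ℝ) ^ (2 / 3 : ℝ)) ^ 2 ≤ (n : ℝ) ^ 2) {N m K : ℕ}
    (hN1 : 1 ≤ N) (hN : (N : ℝ) ≤ 2 * (n : ℝ) ^ (2 / 3 : ℝ))
    (hm : (m : ℝ) ≤ (n : ℝ) ^ (2 / 3 : ℝ) / 400)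
    (hK : 2 * (τ + 3) * (Real.log n / Real.log (Real.log n)) ≤ K) :
    (1 / 2) ^ (n / 4) + 2 ^ m * Real.exp (-(((n / 4 : ℕ) : ℝ) ^ 2 / (2 * (N : ℝ) ^ 2))) +
      (strips N).card * (7 ^ K / K.factorial) ≤ (n : ℝ) ^ (-τ) := by
  obtain ⟨h1, h2, h3, h4, h5⟩ := h
  have hn0 : (0 : ℝ) < n := by linarith
  set q := (n : ℝ) ^ (2 / 3 : ℝ) with hq
  have hq0 : 0 < q := Real.rpow_pos_of_pos hn0 _
  have hq3 : q ^ 3 = (n : ℝ) ^ 2 := by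
    rw [hq, ← Real.rpow_natCast (_ ^ _), ← Real.rpow_mul hn0.le, ← Real.rpow_natCast]
    norm_num
  have hqn : q ≤ n := by
    have := Real.rpow_le_rpow_of_exponent_le (by linarith : (1 : ℝ) ≤ n)
      (by norm_num : (2 / 3 : ℝ) ≤ 1)
    rwa [Real.rpow_one] at this
  have hN0 : (1 : ℝ) ≤ N := by exact_mod_cast hN1
  have hpow : (n : ℝ) ^ (-τ) = Real.exp (-(τ * Real.log n)) := by
    rw [Real.rpow_def_of_pos hn0]
    congr 1
    ring
  have hl : (n : ℝ) / 5 ≤ ((n / 4 : ℕ) : ℝ) := by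
    have h6 : n ≤ 4 * (n / 4) + 3 := by omega
    have h7 : (n : ℝ) ≤ 4 * ((n / 4 : ℕ) : ℝ) + 3 := by exact_mod_cast h6
    linarith
  set l := n / 4
  have he2 : Real.exp (-2) ≤ 1 / 3 := by
    rw [Real.exp_neg, inv_eq_one_div]
    refine one_div_le_one_div_of_le (by norm_num) ?_
    linarith [Real.add_one_le_exp (2 : ℝ)]
  have hsmall : Real.exp (-(q / 400)) ≤ (n : ℝ) ^ (-τ) / 3 := by
    rw [hpow]
    calc Real.exp (-(q / 400)) ≤ Real.exp (-(τ * Real.log n) + -2) :=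
          Real.exp_le_exp.2 (by linarith)
      _ ≤ _ := by
          rw [Real.exp_add]
          have := mul_le_mul_of_nonneg_left he2 (Real.exp_pos (-(τ * Real.log n))).le
          linarith
  have hA : ((1 : ℝ) / 2) ^ l ≤ Real.exp (-(q / 400)) := by
    have h6 : (1 : ℝ) / 2 ≤ Real.exp (-(1 / 2)) := by
      linarith [Real.add_one_le_exp (-(1 / 2) : ℝ)]
    refine (pow_le_pow_left₀ (by norm_num) h6 l).trans ?_
    rw [← Real.exp_nat_mul, Real.exp_le_exp]
    linarith
  have hB : 2 ^ m * Real.exp (-((l : ℝ) ^ 2 / (2 * (N : ℝ) ^ 2))) ≤ Real.exp (-(q / 400)) := by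
    have h6 : (2 : ℝ) ^ m ≤ Real.exp (q / 400) := by
      refine (pow_le_pow_left₀ (by norm_num) (by linarith [Real.add_one_le_exp (1 : ℝ)] :
        (2 : ℝ) ≤ Real.exp 1) m).trans ?_
      rw [← Real.exp_nat_mul, Real.exp_le_exp, mul_one]
      exact hm
    -- From `l ≥ n/5`, `N ≤ 2q` and `n² = q³`; half of this exponent pays for `2 ^ m`.
    have h7 : q / 200 ≤ (l : ℝ) ^ 2 / (2 * (N : ℝ) ^ 2) := by
      rw [le_div_iff₀ (by positivity)]
      have h8 : (N : ℝ) ^ 2 ≤ (2 * q) ^ 2 := pow_le_pow_left₀ (by positivity) hN 2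
      have h9 : ((n : ℝ) / 5) ^ 2 ≤ (l : ℝ) ^ 2 := pow_le_pow_left₀ (by positivity) hl 2
      have h10 := mul_le_mul_of_nonneg_left h8 (by positivity : 0 ≤ q / 100)
      calc q / 200 * (2 * (N : ℝ) ^ 2) = q / 100 * (N : ℝ) ^ 2 := by ring
        _ ≤ q / 100 * (2 * q) ^ 2 := h10
        _ = q ^ 3 / 25 := by ring
        _ = ((n : ℝ) / 5) ^ 2 := by rw [hq3]; ring
        _ ≤ _ := h9
    refine (mul_le_mul h6 (Real.exp_le_exp.2 (neg_le_neg h7)) (Real.exp_pos _).le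
      (Real.exp_pos _).le).trans (le_of_eq ?_)
    rw [← Real.exp_add]
    congr 1
    ring
  -- There are at most `66 N² ≤ 264 q² ≤ n²` strips, each failing with probability at most
  -- `n^(-τ-3)`.
  have hC : ((strips N).card : ℝ) * (7 ^ K / K.factorial) ≤ (n : ℝ) ^ (-τ) / 3 := by
    have h6 := pow_div_factorial_le_exp_neg (by linarith) h3 h4 hK
    have h7 : ((strips N).card : ℝ) ≤ 66 * (N : ℝ) ^ 2 := by
      have h8 : ((strips N).card : ℝ) ≤ 2 * ((2 * N + 1) * (4 * N + 7)) := by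
        exact_mod_cast card_strips_le N
      nlinarith
    have h8 : (N : ℝ) ^ 2 ≤ (2 * q) ^ 2 := pow_le_pow_left₀ (by positivity) hN 2
    have h9 : ((strips N).card : ℝ) ≤ (n : ℝ) ^ 2 := by nlinarith
    have h10 : Real.exp (-(2 * (τ + 3) * Real.log n / 2)) =
        (n : ℝ) ^ (-τ) * ((n : ℝ) ^ 3)⁻¹ := by
      rw [hpow, ← Real.exp_log (by positivity : 0 < (n : ℝ) ^ 3), ← Real.exp_neg, ← Real.exp_add,
        Real.log_pow]
      congr 1
      push_cast
      ring
    rw [h10] at h6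
    have hp : 0 < (n : ℝ) ^ (-τ) := Real.rpow_pos_of_pos hn0 _
    calc _ ≤ (n : ℝ) ^ 2 * ((n : ℝ) ^ (-τ) * ((n : ℝ) ^ 3)⁻¹) := by gcongr
      _ = (n : ℝ) ^ (-τ) / n := by field_simp
      _ ≤ _ := div_le_div_of_nonneg_left hp.le (by norm_num) (by linarith)
  linarith

theorem measure_separability_lt_le {τ : ℝ} (hτ : 0 < τ) {n : ℕ}
    (h : 4096 ≤ (n : ℝ) ∧ τ * Real.log n + 2 ≤ (n : ℝ) ^ (2 / 3 : ℝ) / 400 ∧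
      1 ≤ Real.log (Real.log n) ∧
      20 * Real.log (Real.log n) ≤ Real.sqrt (Real.log n) ∧
      264 * ((n : ℝ) ^ (2 / 3 : ℝ)) ^ 2 ≤ (n : ℝ) ^ 2)
    {Ω : Type*} [MeasurableSpace Ω] (μ : Measure Ω) [IsProbabilityMeasure μ]
    (X : Fin n → Ω → Plane) (hX : ∀ i, pdf.IsUniform (X i) unitSquare μ volume)
    (hind : iIndepFun X μ) :
    μ {ω | (separability (Set.range fun i => X i ω) : ℝ) <
        1 / (800 * (τ + 3)) * ((n : ℝ) ^ (2 / 3 : ℝ) * Real.log (Real.log n) / Real.log n)} ≤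
      ENNReal.ofReal ((n : ℝ) ^ (-τ)) := by
  have hn0 : (0 : ℝ) < n := by linarith [h.1]
  have hq0 : 0 < (n : ℝ) ^ (2 / 3 : ℝ) := Real.rpow_pos_of_pos hn0 _
  have hq1 : 1 ≤ (n : ℝ) ^ (2 / 3 : ℝ) :=
    Real.one_le_rpow (by linarith [h.1]) (by norm_num)
  have hq3 : ((n : ℝ) ^ (2 / 3 : ℝ)) ^ 3 = (n : ℝ) ^ 2 := by
    rw [← Real.rpow_natCast (_ ^ _), ← Real.rpow_mul hn0.le, ← Real.rpow_natCast]
    norm_num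
  have hq2 : 16 * (n : ℝ) ≤ ((n : ℝ) ^ (2 / 3 : ℝ)) ^ 2 := by
    have h16 : (4096 : ℝ) ^ (1 / 3 : ℝ) = 16 := by
      rw [show (4096 : ℝ) = 16 ^ (3 : ℝ) by norm_num, ← Real.rpow_mul (by norm_num)]
      norm_num
    have h17 : (16 : ℝ) ≤ (n : ℝ) ^ (1 / 3 : ℝ) := by
      rw [← h16]
      exact Real.rpow_le_rpow (by norm_num) h.1 (by norm_num)
    have h18 : ((n : ℝ) ^ (2 / 3 : ℝ)) ^ 2 = (n : ℝ) ^ (1 / 3 : ℝ) * n := by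
      rw [← Real.rpow_natCast (_ ^ _), ← Real.rpow_mul hn0.le, ← Real.rpow_add_one hn0.ne']
      norm_num
    rw [h18]
    exact mul_le_mul_of_nonneg_right h17 hn0.le
  have hll : 0 < Real.log (Real.log n) := by linarith [h.2.2.1]
  have hlog : 0 < Real.log n := Real.log_pos (by linarith [h.1])
  set N := ⌈(n : ℝ) ^ (2 / 3 : ℝ)⌉₊
  set m := ⌊(n : ℝ) ^ (2 / 3 : ℝ) / 400⌋₊
  -- Rounding down keeps `K` small enough for the final product, where `2(τ + 3)` against `q/400`
  -- gives `1/(800(τ + 3))`; the tail is taken at `K + 1`, which exceeds the unrounded value.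
  set K := ⌊2 * (τ + 3) * (Real.log n / Real.log (Real.log n))⌋₊
  have hK0 : 0 < 2 * (τ + 3) * (Real.log n / Real.log (Real.log n)) := by positivity
  have hNle : (n : ℝ) ^ (2 / 3 : ℝ) ≤ N := Nat.le_ceil _
  have hN : 0 < N := Nat.ceil_pos.2 hq0
  have hbound := failure_bound_le hτ h (N := N) (m := m) (K := K + 1) hN
    (by linarith [Nat.ceil_lt_add_one hq0.le]) (Nat.floor_le (by positivity))
    (by push_cast; exact (Nat.lt_floor_add_one _).le)
  have hnn : n - n / 4 + n / 4 = n := by omega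
  have hkN : 16 * (n - n / 4) ≤ N ^ 2 := by
    have h1 : 16 * (n : ℝ) ≤ (N : ℝ) ^ 2 := hq2.trans (pow_le_pow_left₀ hq0.le hNle 2)
    have h2 : 16 * n ≤ N ^ 2 := by exact_mod_cast h1
    omega
  have hnN : n ^ 2 ≤ N ^ 3 := by
    have h1 : (n : ℝ) ^ 2 ≤ (N : ℝ) ^ 3 := hq3 ▸ pow_le_pow_left₀ hq0.le hNle 3
    exact_mod_cast h1
  have hmain : μ {ω | separability (Set.range fun i => X i ω) * K ≤ m} ≤
      ENNReal.ofReal ((1 / 2) ^ (n / 4) +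
        2 ^ m * Real.exp (-(((n / 4 : ℕ) : ℝ) ^ 2 / (2 * (N : ℝ) ^ 2))) +
        (strips N).card * (7 ^ (K + 1) / (K + 1).factorial)) := by
    have hgen : ∀ k l : ℕ, k + l = n → 3 * l ≤ k → 16 * k ≤ N ^ 2 →
        μ {ω | separability (Set.range fun i => X i ω) * K ≤ m} ≤
        ENNReal.ofReal ((1 / 2) ^ l + 2 ^ m * Real.exp (-((l : ℝ) ^ 2 / (2 * (N : ℝ) ^ 2))) +
          (strips N).card * (7 ^ (K + 1) / (K + 1).factorial)) := by
      clear_value N m K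
      rintro k l rfl hl hk
      exact measure_separability_mul_le hN hl hk hnN hX hind
    exact hgen (n - n / 4) (n / 4) hnn (by omega) hkN
  refine le_trans (measure_mono fun ω hω => ?_) (hmain.trans (ENNReal.ofReal_le_ofReal hbound))
  have hω' : (separability (Set.range fun i => X i ω) : ℝ) <
    1 / (800 * (τ + 3)) * ((n : ℝ) ^ (2 / 3 : ℝ) * Real.log (Real.log n) / Real.log n) := hω
  refine Nat.le_floor ?_
  push_cast
  calc _ ≤ 1 / (800 * (τ + 3)) * ((n : ℝ) ^ (2 / 3 : ℝ) * Real.log (Real.log n) / Real.log n) *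
        (2 * (τ + 3) * (Real.log n / Real.log (Real.log n))) :=
        mul_le_mul hω'.le (Nat.floor_le hK0.le) (Nat.cast_nonneg _) (by positivity)
    _ = _ := by
        field_simp
        norm_num

end LineSeparation

theorem mainTheorem1 (τ : ℝ) (hτ : 0 < τ) :
    ∃ c : ℝ, 0 < c ∧ ∃ n₀ : ℕ, ∀ n : ℕ, n₀ ≤ n →
      ∀ (Ω : Type*) [MeasurableSpace Ω] (μ : Measure Ω) [IsProbabilityMeasure μ]
        (X : Fin n → Ω → LineSeparation.Plane),
        (∀ i, pdf.IsUniform (X i) LineSeparation.unitSquare μ volume) →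
        iIndepFun X μ →
        μ {ω | (LineSeparation.separability (Set.range fun i => X i ω) : ℝ) <
            c * ((n : ℝ) ^ (2 / 3 : ℝ) * Real.log (Real.log n) / Real.log n)} ≤
          ENNReal.ofReal ((n : ℝ) ^ (-τ)) := by
  refine ⟨1 / (800 * (τ + 3)), by positivity, ?_⟩
  obtain ⟨n₀, hn₀⟩ := Filter.eventually_atTop.1
    (tendsto_natCast_atTop_atTop.eventually (LineSeparation.eventually_growth_conditions τ))
  refine ⟨n₀, fun n hn Ω _ μ _ X hX hind => ?_⟩
  exact LineSeparation.measure_separability_lt_le hτ (hn₀ n hn) μ X hX hind
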